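/- Let $\varepsilon>0$ be real, let $w_1,\beta_s$ be real, and let $\gamma=w_1\beta_s$. Assume $\gamma<0$. Put $$G(q)=(1-\gamma)\cos(q\sqrt\varepsilon)\cos q-\Big(\sqrt\varepsilon-\frac{\gamma}{\sqrt\varepsilon}\Big)\sin(q\sqrt\varepsilon)\sin q .$$ Then the positive roots of the equation $$\tan q=\frac{\gamma}{\sqrt\varepsilon}\tan(q\sqrt\varepsilon)$$ (that is, the real $q>0$ at which both tangents are defined and the equation holds) form a strictly increasing infinite sequence $q_1<q_2<\cdots$, with $G(q_n)\neq0$ for all $n$. For every real $p>0$ the number $\coth(\sqrt{\varepsilon p})\tanh\sqrt p-\gamma/\sqrt\varepsilon$ is nonzero, the series below converges absolutely, and $$\frac{\sqrt\varepsilon}{1-\gamma}+2\sum_{n=1}^{\infty}\frac{\cos q_n\,\sin(q_n\sqrt\varepsilon)}{q_n\,(1+q_n^2/p)\,G(q_n)}=\frac{1}{\coth(\sqrt{\varepsilon p})\tanh\sqrt p-\dfrac{\gamma}{\sqrt\varepsilon}} .$$ -/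

import Mathlib

/-- The hyperbolic cotangent of a real number (used only at nonzero arguments). -/
noncomputable def realCoth (x : ℝ) : ℝ := Real.cosh x / Real.sinh x

/-- The function `G` of the residue series, with parameters `ε` and `γ`. -/
noncomputable def residueG (ε γ q : ℝ) : ℝ :=
  (1 - γ) * Real.cos (q * √ε) * Real.cos q
    - (√ε - γ / √ε) * Real.sin (q * √ε) * Real.sin q

/-- The positive roots of `tan q = (γ / √ε) tan (q √ε)`. The two conditions on the cosines say that
both tangents are defined at `q` (in Mathlib `Real.tan` is `0` at its poles). -/
def posRoots (ε γ : ℝ) : Set ℝ :=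
  {q | 0 < q ∧ Real.cos q ≠ 0 ∧ Real.cos (q * √ε) ≠ 0 ∧
    Real.tan q = γ / √ε * Real.tan (q * √ε)}

open Filter Topology Metric

/-! Put `a = √ε`, `b = -γ / √ε`, `s = √p`; the hypothesis `γ < 0` means `b > 0`. Clearing
denominators turns the tangent equation into `D(q) = 0` with `D(q) = cos (a q) sin q + b sin (a q)
cos q`, and `G` is exactly `D'`. The claimed value is `N / D` at `i s`, where `N(z) = sin (a z) cos
z`, and the formula is the partial fraction expansion of `N / D`.

It comes from integrating `N / (D z (z² + s²))` over growing circles. The residue at `0` gives the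
constant term, those at `± i s` give the right-hand side, and those at `± q n` give the series.
Three facts carry this: * the zeros of `D` are real (`im_eq_zero_of_cCharFn_eq_zero`), and simple
and separated because `|D'| ≥ min 1 b` there (`min_le_abs_charDeriv`); * on suitable circles `|D|`
is at least a constant times `cosh ((1 + a) Im z)`, which bounds `|N|`
(`exists_mul_cosh_le_norm_cCharFn`, `norm_cNum_le`), so the integrals tend to `0`; * a zero of `D`
where a tangent is undefined makes both cosines vanish, hence also `N`, and contributes no residue
(`kernelRes_eq_zero`). -/

/-! ### Residues at simple poles -/

theorem meromorphicOrderAt_nonneg_of_tendsto_sub_mul {g : ℂ → ℂ} {w : ℂ} (hg : MeromorphicAt g w)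
    (h : Tendsto (fun z => (z - w) * g z) (𝓝[≠] w) (𝓝 0)) : 0 ≤ meromorphicOrderAt g w := by
  have hid : MeromorphicAt (fun z : ℂ => z - w) w := by fun_prop
  have h1 : 0 < meromorphicOrderAt ((fun z : ℂ => z - w) * g) w :=
    (tendsto_zero_iff_meromorphicOrderAt_pos (hid.mul hg)).1 h
  have h2 : meromorphicOrderAt (fun z : ℂ => z - w) w = 1 := by
    rw [show (1 : WithTop ℤ) = ((1 : ℤ) : WithTop ℤ) from rfl,
      meromorphicOrderAt_eq_int_iff hid]
    exact ⟨fun _ => 1, analyticAt_const, one_ne_zero, by simp⟩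
  rw [meromorphicOrderAt_mul hid hg, h2] at h1
  cases hn : meromorphicOrderAt g w with
  | top => exact le_top
  | coe n =>
    rw [hn] at h1
    norm_cast at h1 ⊢
    omega

/-- The residue theorem on a disc for a meromorphic function with at most simple poles. -/
theorem circleIntegral_eq_sum_simple_residues {f : ℂ → ℂ} {c : ℂ} {R : ℝ} (hR : 0 < R)
    (hf : MeromorphicOn f Set.univ) (hc : ContinuousOn f (sphere c R)) (S : Finset ℂ) (r : ℂ → ℂ)
    (hS : ∀ w ∈ S, w ∈ ball c R)
    (hr : ∀ w ∈ S, Tendsto (fun z => (z - w) * f z) (𝓝[≠] w) (𝓝 (r w)))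
    (h0 : ∀ w ∈ closedBall c R, w ∉ S → Tendsto (fun z => (z - w) * f z) (𝓝[≠] w) (𝓝 0)) :
    (∮ z in C(c, R), f z) = 2 * Real.pi * Complex.I * ∑ w ∈ S, r w := by
  -- With the principal parts removed, only removable singularities remain in the closed disc.
  set g : ℂ → ℂ := fun z => f z - ∑ w ∈ S, r w * (z - w)⁻¹ with hgdef
  have hg : MeromorphicOn g Set.univ := fun z _ => by
    have := hf z trivial
    fun_prop
  have hord : ∀ w ∈ closedBall c R, AnalyticAt ℂ (toMeromorphicNFOn g Set.univ) w := by
    intro w hw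
    rw [← (meromorphicNFOn_toMeromorphicNFOn g Set.univ
      (Set.mem_univ w)).meromorphicOrderAt_nonneg_iff_analyticAt,
      meromorphicOrderAt_toMeromorphicNFOn hg (Set.mem_univ w)]
    refine meromorphicOrderAt_nonneg_of_tendsto_sub_mul (hg w trivial) ?_
    have hterm : ∀ v ∈ S, Tendsto (fun z => (z - w) * (r v * (z - v)⁻¹)) (𝓝[≠] w)
        (𝓝 (if v = w then r v else 0)) := by
      intro v _
      split_ifs with hvw
      · subst hvw
        refine tendsto_const_nhds.congr' ?_
        filter_upwards [self_mem_nhdsWithin] with z hz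
        have : z - v ≠ 0 := sub_ne_zero.2 hz
        field_simp
      · have hne : w - v ≠ 0 := sub_ne_zero.2 (Ne.symm hvw)
        have hcont : ContinuousAt (fun z => (z - w) * (r v * (z - v)⁻¹)) w := by
          fun_prop (disch := assumption)
        have := hcont.tendsto
        simp only [sub_self, zero_mul] at this
        exact this.mono_left nhdsWithin_le_nhds
    have hsum := tendsto_finsetSum S hterm
    have hf0 : Tendsto (fun z => (z - w) * f z) (𝓝[≠] w) (𝓝 (if w ∈ S then r w else 0)) := by
      split_ifs with hwS
      · exact hr w hwS
      · exact h0 w hw hwS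
    have := hf0.sub hsum
    simp only [Finset.sum_ite_eq', sub_self] at this
    refine this.congr fun z => ?_
    simp only [hgdef, mul_sub, Finset.mul_sum]
  have hzero : (∮ z in C(c, R), g z) = 0 := by
    -- The normal form fills in the removable singularities and changes `g` only off a codiscrete
    -- set, which the integral does not see.
    rw [circleIntegral.circleIntegral_congr_codiscreteWithin
      (f₂ := toMeromorphicNFOn g Set.univ) _ hR.ne']
    · exact Complex.circleIntegral_eq_zero_of_differentiable_on_off_countable hR.le
        Set.countable_empty (fun z hz => (hord z hz).continuousAt.continuousWithinAt)
        fun z hz => (hord z (ball_subset_closedBall hz.1)).differentiableAt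
    · exact (toMeromorphicNFOn_eqOn_codiscrete hg).filter_mono
        (codiscreteWithin_mono (Set.subset_univ _))
  have hint : ∀ w ∈ S, CircleIntegrable (fun z => r w * (z - w)⁻¹) c R := by
    intro w hw
    refine ContinuousOn.circleIntegrable hR.le ?_
    have : ∀ z ∈ sphere c R, z - w ≠ 0 := by
      intro z hz h
      have h2 := hS w hw
      rw [sub_eq_zero] at h
      rw [mem_sphere] at hz
      rw [mem_ball, ← h, hz] at h2
      exact lt_irrefl _ h2
    fun_prop (disch := assumption)
  rw [hgdef, circleIntegral.integral_sub (hc.circleIntegrable hR.le)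
    (CircleIntegrable.fun_sum S hint), circleIntegral.integral_fun_sum hint, sub_eq_zero] at hzero
  rw [hzero, Finset.mul_sum]
  refine Finset.sum_congr rfl fun w hw => ?_
  rw [circleIntegral.integral_const_mul, circleIntegral.integral_sub_inv_of_mem_ball (hS w hw),
    mul_comm]

/-- The residue of a quotient at a simple zero of the denominator. -/
theorem tendsto_sub_mul_div_of_simple_zero {n d : ℂ → ℂ} {w d' : ℂ} (hn : ContinuousAt n w)
    (hd : HasDerivAt d d' w) (hw : d w = 0) (hd' : d' ≠ 0) :
    Tendsto (fun z => (z - w) * (n z / d z)) (𝓝[≠] w) (𝓝 (n w / d')) := by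
  have h1 := (hn.tendsto.mono_left nhdsWithin_le_nhds).div (hasDerivAt_iff_tendsto_slope.1 hd) hd'
  refine h1.congr' ?_
  filter_upwards [self_mem_nhdsWithin] with z hz
  change n z / slope d w z = _
  rw [slope_def_field, hw, sub_zero]
  have : z - w ≠ 0 := sub_ne_zero.2 hz
  field_simp

/-! ### Real characteristic function: simplicity and separation of zeros -/

/-- The characteristic function `cos (a q) sin q + b sin (a q) cos q`. -/
noncomputable def charFn (a b q : ℝ) : ℝ :=
  Real.cos (a * q) * Real.sin q + b * (Real.sin (a * q) * Real.cos q)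

/-- The derivative of the characteristic function. -/
noncomputable def charDeriv (a b q : ℝ) : ℝ :=
  (1 + a * b) * (Real.cos (a * q) * Real.cos q) - (a + b) * (Real.sin (a * q) * Real.sin q)

theorem hasDerivAt_charFn (a b q : ℝ) : HasDerivAt (charFn a b) (charDeriv a b q) q := by
  have h1 : HasDerivAt (fun x : ℝ => a * x) a q := by simpa using (hasDerivAt_id q).const_mul a
  have := (h1.cos.mul (Real.hasDerivAt_sin q)).add
    ((h1.sin.mul (Real.hasDerivAt_cos q)).const_mul b)
  refine this.congr_deriv ?_
  rw [charDeriv]; ring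

theorem hasDerivAt_charDeriv (a b q : ℝ) : HasDerivAt (charDeriv a b)
    (-(1 + a * b) * (a * (Real.sin (a * q) * Real.cos q) + Real.cos (a * q) * Real.sin q)
      - (a + b) * (a * (Real.cos (a * q) * Real.sin q) + Real.sin (a * q) * Real.cos q)) q := by
  have h1 : HasDerivAt (fun x : ℝ => a * x) a q := by simpa using (hasDerivAt_id q).const_mul a
  have := ((h1.cos.mul (Real.hasDerivAt_cos q)).const_mul (1 + a * b)).sub
    ((h1.sin.mul (Real.hasDerivAt_sin q)).const_mul (a + b))
  refine this.congr_deriv ?_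
  ring

/-- The derivative of the characteristic function is bounded below at its zeros. -/
theorem min_le_abs_charDeriv {a b q : ℝ} (ha : 0 < a) (hb : 0 < b) (h : charFn a b q = 0) :
    min 1 b ≤ |charDeriv a b q| := by
  have e1 := Real.sin_sq_add_cos_sq q
  have e2 := Real.sin_sq_add_cos_sq (a * q)
  rw [charFn] at h
  rw [charDeriv]
  set u := Real.sin q
  set v := Real.cos q
  set s := Real.sin (a * q)
  set t := Real.cos (a * q)
  set W := t * v - b * (s * u) with hW
  set E := (1 + a * b) * (t * v) - (a + b) * (s * u) with hE
  -- Rotating the vector `(t, b s)` by the angle `q` gives `W` and the characteristic function as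
  -- coordinates; the latter is zero here.
  have hWW : W ^ 2 = t ^ 2 + b ^ 2 * s ^ 2 := by
    linear_combination (t ^ 2 + b ^ 2 * s ^ 2) * e1 - (t * u + b * (s * v)) * h
  -- `E = W + a (b t v - s u)`, and at a zero `W (b t v - s u) = b`. Hence `|W| |E| ≥ W²`, so `|E| ≥
  -- |W|`.
  have hWE : W * E = W ^ 2 + a * b := by
    linear_combination (a * b) * ((s ^ 2 + t ^ 2) * e1 + e2) - a * (s * v + b * (t * u)) * h
  have hm : min 1 b ^ 2 ≤ W ^ 2 := by
    have hm0 : 0 ≤ min 1 b := le_min zero_le_one hb.le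
    have hm1 : min 1 b ^ 2 ≤ 1 := by
      have := min_le_left 1 b
      nlinarith
    have hm2 : min 1 b ^ 2 ≤ b ^ 2 := pow_le_pow_left₀ hm0 (min_le_right 1 b) 2
    nlinarith [mul_le_mul_of_nonneg_right hm1 (sq_nonneg t),
      mul_le_mul_of_nonneg_right hm2 (sq_nonneg s)]
  have hmW : min 1 b ≤ |W| := by
    have := sq_le_sq.1 hm
    exact (le_abs_self _).trans this
  have hpos : 0 < min 1 b := lt_min one_pos hb
  refine hmW.trans (le_of_mul_le_mul_left ?_ (hpos.trans_le hmW))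
  rw [← abs_mul, ← abs_mul, hWE, ← sq, abs_of_nonneg (sq_nonneg W)]
  exact (le_add_of_nonneg_right (by positivity)).trans (le_abs_self _)

theorem charDeriv_ne_zero {a b q : ℝ} (ha : 0 < a) (hb : 0 < b) (h : charFn a b q = 0) :
    charDeriv a b q ≠ 0 := by
  have := min_le_abs_charDeriv ha hb h
  have hpos : 0 < min 1 b := lt_min one_pos hb
  exact abs_pos.1 (hpos.trans_le this)

/-- The zeros of the characteristic function are uniformly separated. -/
theorem exists_charFn_gap {a b : ℝ} (ha : 0 < a) (hb : 0 < b) :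
    ∃ d > 0, ∀ q q', charFn a b q = 0 → charFn a b q' = 0 → q < q' → d ≤ q' - q := by
  -- `K` bounds the second derivative. By Rolle the first derivative vanishes between two zeros, yet
  -- it is at least `min 1 b` in size at `q`; covering that drop takes length `min 1 b / K`.
  set K := (1 + a * b) * (a + 1) + (a + b) * (a + 1) with hK
  have hKpos : 0 < K := by positivity
  refine ⟨min 1 b / K, div_pos (lt_min one_pos hb) hKpos, fun q q' h h' hlt => ?_⟩
  obtain ⟨ξ, hξ, hd⟩ := exists_hasDerivAt_eq_zero (f := charFn a b) hlt
    (fun x _ => (hasDerivAt_charFn a b x).continuousAt.continuousWithinAt) (h.trans h'.symm)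
    fun x _ => hasDerivAt_charFn a b x
  have hprod : ∀ x y : ℝ, |x| ≤ 1 → |y| ≤ 1 → |x * y| ≤ 1 := fun x y hx hy => by
    rw [abs_mul]; exact mul_le_one₀ hx (abs_nonneg _) hy
  have hbound := Convex.norm_image_sub_le_of_norm_hasDerivWithin_le (s := Set.univ) (C := K)
    (x := ξ) (y := q) (fun x _ => (hasDerivAt_charDeriv a b x).hasDerivWithinAt) (fun x _ => ?_)
    convex_univ trivial trivial
  · rw [hd, sub_zero, Real.norm_eq_abs, Real.norm_eq_abs] at hbound
    rw [div_le_iff₀ hKpos]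
    have h1 := min_le_abs_charDeriv ha hb h
    have h2 : |q - ξ| ≤ q' - q := by
      rw [abs_le]; constructor <;> linarith [hξ.1, hξ.2]
    nlinarith
  · have h1 := abs_le.1 (hprod _ _ (Real.abs_sin_le_one (a * x)) (Real.abs_cos_le_one x))
    have h2 := abs_le.1 (hprod _ _ (Real.abs_cos_le_one (a * x)) (Real.abs_sin_le_one x))
    set S := Real.sin (a * x) * Real.cos x
    set T := Real.cos (a * x) * Real.sin x
    have hX : |a * S + T| ≤ a + 1 := by
      rw [abs_le]; constructor <;> nlinarith [h1.1, h1.2, h2.1, h2.2]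
    have hY : |a * T + S| ≤ a + 1 := by
      rw [abs_le]; constructor <;> nlinarith [h1.1, h1.2, h2.1, h2.2]
    have hp1 : 0 < 1 + a * b := by positivity
    have hp2 : 0 < a + b := by positivity
    rw [Real.norm_eq_abs]
    refine (abs_sub _ _).trans (add_le_add ?_ ?_)
    · rw [abs_mul, abs_neg, abs_of_pos hp1]; gcongr
    · rw [abs_mul, abs_of_pos hp2]; gcongr

/-! ### Infinitely many real roots -/

theorem charFn_eq_sin_add_sin (a b q : ℝ) : charFn a b q =
    (1 + b) / 2 * Real.sin ((1 + a) * q) + (1 - b) / 2 * Real.sin ((1 - a) * q) := by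
  rw [charFn, show (1 + a) * q = q + a * q by ring, show (1 - a) * q = q - a * q by ring,
    Real.sin_add, Real.sin_sub]
  ring

/-- Radii at which `|sin ((1 + a) x)|` is maximal. -/
noncomputable def radius (a : ℝ) (k : ℕ) : ℝ := (k * Real.pi + Real.pi / 2) / (1 + a)

theorem radius_pos {a : ℝ} (ha : 0 < a) (k : ℕ) : 0 < radius a k := by
  have := Real.pi_pos
  unfold radius; positivity

theorem radius_succ {a : ℝ} (k : ℕ) : radius a (k + 1) = radius a k + Real.pi / (1 + a) := by
  unfold radius; push_cast; ring

theorem tendsto_radius {a : ℝ} (ha : 0 < a) : Tendsto (radius a) atTop atTop := by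
  unfold radius
  refine Tendsto.atTop_div_const (by positivity) (tendsto_atTop_add_const_right _ _ ?_)
  exact tendsto_natCast_atTop_atTop.atTop_mul_const Real.pi_pos

/-- The sine of frequency `1 + a` is `(-1) ^ k` at this radius, and its coefficient `(1 + b) / 2`
exceeds `|1 - b| / 2`, so it fixes the sign. -/
theorem charFn_radius_pos {a b : ℝ} (ha : 0 < a) (hb : 0 < b) (k : ℕ) :
    0 < (-1) ^ k * charFn a b (radius a k) := by
  have h1 : (1 + a) * radius a k = Real.pi / 2 + k * Real.pi := by
    unfold radius; field_simp; ring
  rw [charFn_eq_sin_add_sin, h1, Real.sin_add_nat_mul_pi, Real.sin_pi_div_two]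
  set s := Real.sin ((1 - a) * radius a k)
  have hs := abs_le.1 (Real.abs_sin_le_one ((1 - a) * radius a k))
  have hpos : ∀ σ : ℝ, -1 ≤ σ → σ ≤ 1 → 0 < (1 + σ) + b * (1 - σ) := fun σ hσ hσ' => by
    rcases le_total σ 0 with h | h <;> nlinarith
  rcases neg_one_pow_eq_or ℝ k with h | h <;> rw [h]
  · linarith [hpos s hs.1 hs.2]
  · linarith [hpos (-s) (by linarith [hs.2]) (by linarith [hs.1])]

theorem exists_charFn_zero_mem_Ioo {a b : ℝ} (ha : 0 < a) (hb : 0 < b) (k : ℕ) :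
    ∃ q ∈ Set.Ioo (radius a k) (radius a (k + 1)), charFn a b q = 0 := by
  have h1 := charFn_radius_pos ha hb k
  have h2 := charFn_radius_pos ha hb (k + 1)
  have hle : radius a k ≤ radius a (k + 1) := by
    rw [radius_succ]; linarith [div_pos Real.pi_pos (show 0 < 1 + a by linarith)]
  have hc : ContinuousOn (charFn a b) (Set.Icc (radius a k) (radius a (k + 1))) :=
    fun x _ => (hasDerivAt_charFn a b x).continuousAt.continuousWithinAt
  rw [pow_succ] at h2
  rcases neg_one_pow_eq_or ℝ k with h | h <;> rw [h] at h1 h2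
  · obtain ⟨q, hq, h0⟩ := intermediate_value_Ioo' hle hc
      (show (0 : ℝ) ∈ Set.Ioo _ _ from ⟨by linarith, by linarith⟩)
    exact ⟨q, hq, h0⟩
  · obtain ⟨q, hq, h0⟩ := intermediate_value_Ioo hle hc
      (show (0 : ℝ) ∈ Set.Ioo _ _ from ⟨by linarith, by linarith⟩)
    exact ⟨q, hq, h0⟩

theorem pi_le_sub_of_cos_eq_zero {x y : ℝ} (hx : Real.cos x = 0) (hy : Real.cos y = 0)
    (h : x < y) : Real.pi ≤ y - x := by
  by_contra! hlt
  have := Real.sin_pos_of_pos_of_lt_pi (sub_pos.2 h) hlt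
  rw [Real.sin_sub, hx, hy] at this
  simp at this

/-- A zero of the characteristic function at which one cosine vanishes is a zero of both. -/
theorem cos_eq_zero_of_charFn_eq_zero {a b q : ℝ} (hb : b ≠ 0) (h : charFn a b q = 0)
    (hc : Real.cos q = 0 ∨ Real.cos (a * q) = 0) : Real.cos q = 0 ∧ Real.cos (a * q) = 0 := by
  have e1 := Real.sin_sq_add_cos_sq q
  have e2 := Real.sin_sq_add_cos_sq (a * q)
  rw [charFn] at h
  rcases hc with hc | hc
  · refine ⟨hc, ?_⟩
    rw [hc] at h e1
    have : Real.sin q ≠ 0 := by rintro h0; simp [h0] at e1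
    simpa [this] using h
  · refine ⟨?_, hc⟩
    rw [hc] at h e2
    have : Real.sin (a * q) ≠ 0 := by rintro h0; simp [h0] at e2
    simpa [this, hb] using h

/-- Zeros in two adjacent intervals differ by less than `2π / (1 + a)`. If both were degenerate, the
cosines of `x` and of `a x` would vanish at both, making the difference and `a` times it at least
`π`; adding the two bounds is a contradiction. -/
theorem exists_charFn_zero_gt {a b : ℝ} (ha : 0 < a) (hb : 0 < b) (M : ℝ) :
    ∃ q > M, charFn a b q = 0 ∧ Real.cos q ≠ 0 ∧ Real.cos (a * q) ≠ 0 := by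
  obtain ⟨k, hk⟩ := ((tendsto_radius ha).eventually_gt_atTop M).exists
  obtain ⟨q, hq, h0⟩ := exists_charFn_zero_mem_Ioo ha hb k
  obtain ⟨q', hq', h0'⟩ := exists_charFn_zero_mem_Ioo ha hb (k + 1)
  by_contra! hcon
  have key : ∀ x > M, charFn a b x = 0 → Real.cos x = 0 ∧ Real.cos (a * x) = 0 := by
    intro x hx hx0
    refine cos_eq_zero_of_charFn_eq_zero hb.ne' hx0 ?_
    by_cases hc : Real.cos x = 0
    · exact Or.inl hc
    · exact Or.inr (hcon x hx hx0 hc)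
  have hlt : q < q' := hq.2.trans hq'.1
  have k1 := key q (hk.trans hq.1) h0
  have k2 := key q' (hk.trans (hq.1.trans hlt)) h0'
  have g1 := pi_le_sub_of_cos_eq_zero k1.1 k2.1 hlt
  have g2 := pi_le_sub_of_cos_eq_zero k1.2 k2.2 (mul_lt_mul_of_pos_left hlt ha)
  have g3 : q' - q < 2 * (Real.pi / (1 + a)) := by
    have e1 := radius_succ (a := a) k
    have e2 := radius_succ (a := a) (k + 1)
    linarith [hq.1, hq'.2]
  have h1a : (0 : ℝ) < 1 + a := by linarith
  have g4 : (q' - q) * (1 + a) < 2 * Real.pi := by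
    rw [← lt_div_iff₀ h1a]; rwa [mul_div_assoc]
  nlinarith [Real.pi_pos]

/-! ### Enumeration of a separated set -/

/-- An unbounded set of positive reals, uniformly separated together with `0`, is the range of a
strictly increasing sequence of at least linear growth. -/
theorem exists_strictMono_range_eq {s : Set ℝ} {d : ℝ} (hd : 0 < d) (hlow : ∀ x ∈ s, d ≤ x)
    (hgap : ∀ x ∈ s, ∀ y ∈ s, x < y → d ≤ y - x) (hunb : ∀ M, ∃ x ∈ s, M < x) :
    ∃ q : ℕ → ℝ, StrictMono q ∧ Set.range q = s ∧ ∀ n : ℕ, d * (n + 1) ≤ q n := by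
  -- Separation by `d` makes `⌊x / d⌋₊` strictly increasing on `s`, so `s` inherits the order type
  -- of an infinite subset of `ℕ`.
  set g : ℝ → ℕ := fun x => ⌊x / d⌋₊ with hg
  have hmono : ∀ x ∈ s, ∀ y ∈ s, x < y → g x < g y := by
    intro x hx y hy hxy
    have h1 := hgap x hx y hy hxy
    rw [hg, Nat.lt_iff_add_one_le]
    refine Nat.le_floor ?_
    push_cast
    have h2 := Nat.floor_le (div_nonneg (hd.le.trans (hlow x hx)) hd.le)
    have h3 : x / d + 1 ≤ y / d := by
      rw [div_add_one hd.ne']; gcongr; linarith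
    linarith
  have hinf : (g '' s).Infinite := by
    rw [Set.infinite_iff_exists_gt]
    intro n
    obtain ⟨x, hx, hnx⟩ := hunb (d * (n + 1))
    refine ⟨g x, ⟨x, hx, rfl⟩, Nat.lt_iff_add_one_le.2 (Nat.le_floor ?_)⟩
    rw [le_div_iff₀ hd]; push_cast; linarith
  have := hinf.to_subtype
  classical
  let e : ℕ ≃o (g '' s) := Nat.Subtype.orderIsoOfNat (g '' s)
  choose q hqs hqe using fun n => (e n).2
  have hqm : StrictMono q := by
    intro m n hmn
    by_contra! hle
    have h1 : ((e m : g '' s) : ℕ) < (e n : g '' s) := e.strictMono hmn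
    rw [← hqe m, ← hqe n] at h1
    rcases hle.eq_or_lt with h | h
    · rw [h] at h1; exact lt_irrefl _ h1
    · exact lt_asymm h1 (hmono _ (hqs n) _ (hqs m) h)
  refine ⟨q, hqm, Set.Subset.antisymm ?_ ?_, ?_⟩
  · rintro _ ⟨n, rfl⟩; exact hqs n
  · intro x hx
    refine ⟨e.symm ⟨g x, x, hx, rfl⟩, ?_⟩
    have h1 := hqe (e.symm ⟨g x, x, hx, rfl⟩)
    rw [e.apply_symm_apply] at h1
    rcases lt_trichotomy (q (e.symm ⟨g x, x, hx, rfl⟩)) x with h | h | h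
    · exact absurd h1 (hmono _ (hqs _) _ hx h).ne
    · exact h
    · exact absurd h1 (hmono _ hx _ (hqs _) h).ne'
  · intro n
    induction n with
    | zero => simpa using hlow _ (hqs 0)
    | succ n ih =>
      have := hgap _ (hqs n) _ (hqs (n + 1)) (hqm n.lt_succ_self)
      push_cast
      linarith

/-! ### Complex sine and cosine -/

theorem Complex.sin_re (z : ℂ) : (Complex.sin z).re = Real.sin z.re * Real.cosh z.im := by
  rw [Complex.sin_eq, ← Complex.ofReal_sin, ← Complex.ofReal_cos, ← Complex.ofReal_cosh,
    ← Complex.ofReal_sinh]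
  simp [-Complex.ofReal_sin, -Complex.ofReal_cos, -Complex.ofReal_cosh, -Complex.ofReal_sinh]

theorem Complex.sin_im (z : ℂ) : (Complex.sin z).im = Real.cos z.re * Real.sinh z.im := by
  rw [Complex.sin_eq, ← Complex.ofReal_sin, ← Complex.ofReal_cos, ← Complex.ofReal_cosh,
    ← Complex.ofReal_sinh]
  simp [-Complex.ofReal_sin, -Complex.ofReal_cos, -Complex.ofReal_cosh, -Complex.ofReal_sinh]

theorem Complex.cos_re (z : ℂ) : (Complex.cos z).re = Real.cos z.re * Real.cosh z.im := by
  rw [Complex.cos_eq, ← Complex.ofReal_sin, ← Complex.ofReal_cos, ← Complex.ofReal_cosh,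
    ← Complex.ofReal_sinh]
  simp [-Complex.ofReal_sin, -Complex.ofReal_cos, -Complex.ofReal_cosh, -Complex.ofReal_sinh]

theorem Complex.cos_im (z : ℂ) : (Complex.cos z).im = -(Real.sin z.re * Real.sinh z.im) := by
  rw [Complex.cos_eq, ← Complex.ofReal_sin, ← Complex.ofReal_cos, ← Complex.ofReal_cosh,
    ← Complex.ofReal_sinh]
  simp [-Complex.ofReal_sin, -Complex.ofReal_cos, -Complex.ofReal_cosh, -Complex.ofReal_sinh]

theorem Complex.norm_sin_sq (z : ℂ) :
    ‖Complex.sin z‖ ^ 2 = Real.cosh z.im ^ 2 - Real.cos z.re ^ 2 := by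
  rw [Complex.sq_norm, Complex.normSq_apply, Complex.sin_re, Complex.sin_im]
  have e1 := Real.sin_sq_add_cos_sq z.re
  have e2 := Real.cosh_sq z.im
  linear_combination Real.cosh z.im ^ 2 * e1 - Real.cos z.re ^ 2 * e2

theorem Complex.norm_cos_sq (z : ℂ) :
    ‖Complex.cos z‖ ^ 2 = Real.cosh z.im ^ 2 - Real.sin z.re ^ 2 := by
  rw [Complex.sq_norm, Complex.normSq_apply, Complex.cos_re, Complex.cos_im]
  have e1 := Real.sin_sq_add_cos_sq z.re
  have e2 := Real.cosh_sq z.im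
  linear_combination Real.cosh z.im ^ 2 * e1 - Real.sin z.re ^ 2 * e2

theorem Complex.norm_sin_le_cosh (z : ℂ) : ‖Complex.sin z‖ ≤ Real.cosh z.im := by
  refine le_of_sq_le_sq ?_ (Real.cosh_pos _).le
  rw [Complex.norm_sin_sq]
  linarith [sq_nonneg (Real.cos z.re)]

theorem Complex.norm_cos_le_cosh (z : ℂ) : ‖Complex.cos z‖ ≤ Real.cosh z.im := by
  refine le_of_sq_le_sq ?_ (Real.cosh_pos _).le
  rw [Complex.norm_cos_sq]
  linarith [sq_nonneg (Real.sin z.re)]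

/-! ### Complex characteristic function: reality of zeros -/

/-- The characteristic function on the complex plane. -/
noncomputable def cCharFn (a b : ℝ) (z : ℂ) : ℂ :=
  Complex.cos (a * z) * Complex.sin z + b * (Complex.sin (a * z) * Complex.cos z)

/-- The derivative of the complex characteristic function. -/
noncomputable def cCharDeriv (a b : ℝ) (z : ℂ) : ℂ :=
  (1 + a * b) * (Complex.cos (a * z) * Complex.cos z)
    - (a + b) * (Complex.sin (a * z) * Complex.sin z)

theorem cCharFn_ofReal (a b q : ℝ) : cCharFn a b q = charFn a b q := by
  simp [cCharFn, charFn]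

theorem cCharDeriv_ofReal (a b q : ℝ) : cCharDeriv a b q = charDeriv a b q := by
  simp [cCharDeriv, charDeriv]

theorem hasDerivAt_cCharFn (a b : ℝ) (z : ℂ) :
    HasDerivAt (cCharFn a b) (cCharDeriv a b z) z := by
  have h1 : HasDerivAt (fun x : ℂ => a * x) a z := by simpa using (hasDerivAt_id z).const_mul (a : ℂ)
  have := (h1.ccos.mul (Complex.hasDerivAt_sin z)).add
    ((h1.csin.mul (Complex.hasDerivAt_cos z)).const_mul (b : ℂ))
  refine this.congr_deriv ?_
  rw [cCharDeriv]; ring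

theorem cCharFn_neg (a b : ℝ) (z : ℂ) : cCharFn a b (-z) = -cCharFn a b z := by
  simp only [cCharFn, mul_neg, Complex.sin_neg, Complex.cos_neg]; ring

theorem cCharDeriv_neg (a b : ℝ) (z : ℂ) : cCharDeriv a b (-z) = cCharDeriv a b z := by
  simp only [cCharDeriv, mul_neg, Complex.sin_neg, Complex.cos_neg]; ring

theorem cCharFn_eq_sin_add_sin (a b : ℝ) (z : ℂ) : cCharFn a b z =
    (1 + b) / 2 * Complex.sin ((1 + a : ℝ) * z) + (1 - b) / 2 * Complex.sin ((1 - a : ℝ) * z) := by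
  push_cast
  rw [cCharFn, show (1 + a : ℂ) * z = z + a * z by ring,
    show (1 - a : ℂ) * z = z - a * z by ring, Complex.sin_add, Complex.sin_sub]
  ring

theorem mul_sinh_mul_cosh_pos {y : ℝ} (hy : y ≠ 0) : 0 < y * (Real.sinh y * Real.cosh y) := by
  have := Real.cosh_pos y
  rcases hy.lt_or_gt with h | h
  · have h2 := Real.sinh_neg_iff.2 h
    have := mul_pos_of_neg_of_neg h h2
    rw [← mul_assoc]; positivity
  · have h2 := Real.sinh_pos_iff.2 h
    positivity

/-- All zeros of the characteristic function are real. -/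
theorem im_eq_zero_of_cCharFn_eq_zero {a b : ℝ} (ha : 0 < a) (hb : 0 < b) {z : ℂ}
    (h : cCharFn a b z = 0) : z.im = 0 := by
  by_contra hy
  have hre := congrArg Complex.re h
  have him := congrArg Complex.im h
  have hcos : 0 < ‖Complex.cos z‖ ^ 2 := by
    rw [Complex.norm_cos_sq, Real.cosh_sq]
    have h1 := Real.sin_sq_le_one z.re
    have h2 : Real.sinh z.im ≠ 0 := by rwa [Ne, Real.sinh_eq_zero]
    have h3 : 0 < Real.sinh z.im ^ 2 := by positivity
    linarith
  have k1 := mul_sinh_mul_cosh_pos hy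
  have k2 := mul_sinh_mul_cosh_pos (mul_ne_zero ha.ne' hy)
  have key : Real.sinh z.im * Real.cosh z.im * ‖Complex.cos (a * z)‖ ^ 2
      + b * (Real.sinh (a * z.im) * Real.cosh (a * z.im)) * ‖Complex.cos z‖ ^ 2 = 0 := by
    -- This is the imaginary part of `tan z + b tan (a z)` cleared of denominators. Both summands
    -- have the sign of `Im z`, so they cannot cancel off the real axis.
    have hmain : (cCharFn a b z * (starRingEnd ℂ (Complex.cos z) *
        starRingEnd ℂ (Complex.cos (a * z)))).im = 0 := by rw [h]; simp
    have e1 := Real.sin_sq_add_cos_sq z.re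
    have e2 := Real.sin_sq_add_cos_sq (a * z.re)
    rw [Complex.sq_norm, Complex.sq_norm, Complex.normSq_apply, Complex.normSq_apply]
    simp only [cCharFn, Complex.mul_re, Complex.mul_im, Complex.add_re, Complex.add_im,
      Complex.conj_re, Complex.conj_im, Complex.sin_re, Complex.sin_im, Complex.cos_re,
      Complex.cos_im, Complex.ofReal_re, Complex.ofReal_im, zero_mul, sub_zero, add_zero]
      at hmain ⊢
    linear_combination hmain
      - Real.sinh z.im * Real.cosh z.im * ((Real.cos (a * z.re) * Real.cosh (a * z.im)) ^ 2 +
        (Real.sin (a * z.re) * Real.sinh (a * z.im)) ^ 2) * e1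
      - b * (Real.sinh (a * z.im) * Real.cosh (a * z.im)) *
        ((Real.cos z.re * Real.cosh z.im) ^ 2 + (Real.sin z.re * Real.sinh z.im) ^ 2) * e2
  have k3 : 0 < z.im * (b * (Real.sinh (a * z.im) * Real.cosh (a * z.im))) := by
    have : z.im * (b * (Real.sinh (a * z.im) * Real.cosh (a * z.im))) =
      b / a * (a * z.im * (Real.sinh (a * z.im) * Real.cosh (a * z.im))) := by field_simp
    rw [this]; positivity
  have k4 := mul_pos k3 hcos
  have k5 := mul_nonneg k1.le (sq_nonneg ‖Complex.cos (a * z)‖)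
  have : z.im * (Real.sinh z.im * Real.cosh z.im * ‖Complex.cos (a * z)‖ ^ 2
      + b * (Real.sinh (a * z.im) * Real.cosh (a * z.im)) * ‖Complex.cos z‖ ^ 2) = 0 := by
    rw [key, mul_zero]
  linarith

/-! ### Lower bound on large circles -/

theorem Real.sq_le_cosh_sq (t : ℝ) : t ^ 2 ≤ Real.cosh t ^ 2 := by
  have h : |t| ≤ Real.sinh |t| := Real.self_le_sinh_iff.2 (abs_nonneg t)
  have h2 : t ^ 2 ≤ Real.sinh t ^ 2 := by
    rw [← sq_abs t, ← sq_abs (Real.sinh t), Real.abs_sinh]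
    gcongr
  rw [Real.cosh_sq]; linarith

/-- On the circle of radius `radius a k`, the real part of `z` is close to an extremum of
`sin ((1 + a) x)`. -/
theorem mul_cos_sq_le_cosh_sq {a : ℝ} (ha : 0 < a) (k : ℕ) {z : ℂ} (hz : ‖z‖ = radius a k) :
    (1 + a) * radius a k * Real.cos ((1 + a) * z.re) ^ 2 ≤ Real.cosh ((1 + a) * z.im) ^ 2 := by
  set R := radius a k with hR
  have hRpos : 0 < R := radius_pos ha k
  have hA : 0 < 1 + a := by linarith
  have hxR : |z.re| ≤ R := hz ▸ Complex.abs_re_le_norm z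
  have hRR : (1 + a) * R = k * Real.pi + Real.pi / 2 := by
    rw [hR, radius]; field_simp
  have hsq : R ^ 2 = |z.re| ^ 2 + z.im ^ 2 := by
    rw [← hz, Complex.sq_norm, Complex.normSq_apply, sq_abs]; ring
  have hcos : |Real.cos ((1 + a) * z.re)| ≤ (1 + a) * (R - |z.re|) := by
    have e1 : |Real.cos ((1 + a) * z.re)| = |Real.sin ((1 + a) * (R - |z.re|))| := by
      rw [← Real.cos_abs, abs_mul, abs_of_pos hA,
        show (1 + a) * |z.re| = (Real.pi / 2 - (1 + a) * (R - |z.re|)) + k * Real.pi by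
          rw [mul_sub, hRR]; ring, Real.cos_add_nat_mul_pi, Real.cos_pi_div_two_sub, abs_mul]
      simp
    rw [e1]
    refine Real.abs_sin_le_abs.trans (le_of_eq (abs_of_nonneg ?_))
    exact mul_nonneg hA.le (sub_nonneg.2 hxR)
  -- Since `|cos| ≤ 1`, the square of the cosine is at most its absolute value, so the linear bound
  -- suffices.
  have h1 : Real.cos ((1 + a) * z.re) ^ 2 ≤ (1 + a) * (R - |z.re|) := by
    rw [← sq_abs]
    have := Real.abs_cos_le_one ((1 + a) * z.re)
    nlinarith [abs_nonneg (Real.cos ((1 + a) * z.re))]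
  have h2 : R * (R - |z.re|) ≤ z.im ^ 2 := by nlinarith [abs_nonneg z.re]
  calc (1 + a) * R * Real.cos ((1 + a) * z.re) ^ 2
      ≤ (1 + a) * R * ((1 + a) * (R - |z.re|)) := by gcongr
    _ = (1 + a) ^ 2 * (R * (R - |z.re|)) := by ring
    _ ≤ (1 + a) ^ 2 * z.im ^ 2 := by gcongr
    _ = ((1 + a) * z.im) ^ 2 := by ring
    _ ≤ _ := Real.sq_le_cosh_sq _

/-- The characteristic function is of maximal growth on the circles of radius `radius a k`. -/
theorem exists_mul_cosh_le_norm_cCharFn {a b : ℝ} (ha : 0 < a) (hb : 0 < b) :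
    ∃ c > 0, ∀ᶠ k in atTop, ∀ z : ℂ, ‖z‖ = radius a k →
      c * Real.cosh ((1 + a) * z.im) ≤ ‖cCharFn a b z‖ := by
  have hA : 0 < 1 + a := by linarith
  have hlim : Tendsto (fun k => ((1 + b) * √(1 - ((1 + a) * radius a k)⁻¹) - |1 - b|) / 2) atTop
      (𝓝 (((1 + b) * √(1 - 0) - |1 - b|) / 2)) := by
    have h1 := tendsto_inv_atTop_zero.comp ((tendsto_radius ha).const_mul_atTop hA)
    exact ((((h1.const_sub 1).sqrt).const_mul (1 + b)).sub_const _).div_const 2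
  rw [sub_zero, Real.sqrt_one, mul_one] at hlim
  have hpos : 0 < (1 + b - |1 - b|) / 2 := by
    have : |1 - b| < 1 + b := by rw [abs_lt]; constructor <;> linarith
    linarith
  -- Half the limiting coefficient: the square root is below `1` at each finite radius, and the
  -- halving absorbs the loss.
  refine ⟨(1 + b - |1 - b|) / 2 / 2, by positivity, ?_⟩
  filter_upwards [hlim.eventually_const_lt (half_lt_self hpos),
    (tendsto_radius ha).eventually_ge_atTop (1 + a)⁻¹] with k hk hk1 z hz
  set R := radius a k
  set C := Real.cosh ((1 + a) * z.im)
  have hC : 0 < C := Real.cosh_pos _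
  have hAR : 1 ≤ (1 + a) * R := by rwa [inv_le_iff_one_le_mul₀' hA] at hk1
  have hARpos : 0 < (1 + a) * R := by linarith
  have h1 : √(1 - ((1 + a) * R)⁻¹) * C ≤ ‖Complex.sin ((1 + a : ℝ) * z)‖ := by
    refine le_of_sq_le_sq ?_ (norm_nonneg _)
    rw [Complex.norm_sin_sq, mul_pow, Real.sq_sqrt (sub_nonneg.2 (inv_le_one_of_one_le₀ hAR)),
      Complex.re_ofReal_mul, Complex.im_ofReal_mul]
    have := mul_cos_sq_le_cosh_sq ha k hz
    have h3 : Real.cos ((1 + a) * z.re) ^ 2 ≤ ((1 + a) * R)⁻¹ * C ^ 2 := by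
      rw [inv_mul_eq_div, le_div_iff₀ hARpos]; linarith
    linarith
  have h2 : ‖Complex.sin ((1 - a : ℝ) * z)‖ ≤ C := by
    refine (Complex.norm_sin_le_cosh _).trans ?_
    rw [Complex.im_ofReal_mul, Real.cosh_le_cosh, abs_mul, abs_mul]
    refine mul_le_mul_of_nonneg_right ?_ (abs_nonneg _)
    rw [abs_of_pos hA, abs_le]; constructor <;> linarith
  have n1 : ‖((1 + b) / 2 : ℂ)‖ = (1 + b) / 2 := by
    rw [show ((1 + b) / 2 : ℂ) = (((1 + b) / 2 : ℝ) : ℂ) by push_cast; ring,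
      Complex.norm_real, Real.norm_of_nonneg (by positivity)]
  have n2 : ‖((1 - b) / 2 : ℂ)‖ = |1 - b| / 2 := by
    rw [show ((1 - b) / 2 : ℂ) = (((1 - b) / 2 : ℝ) : ℂ) by push_cast; ring,
      Complex.norm_real, Real.norm_eq_abs, abs_div, abs_two]
  rw [cCharFn_eq_sin_add_sin]
  calc (1 + b - |1 - b|) / 2 / 2 * C
      ≤ ((1 + b) * √(1 - ((1 + a) * R)⁻¹) - |1 - b|) / 2 * C := by gcongr
    _ = (1 + b) / 2 * (√(1 - ((1 + a) * R)⁻¹) * C) - |1 - b| / 2 * C := by ring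
    _ ≤ (1 + b) / 2 * ‖Complex.sin ((1 + a : ℝ) * z)‖
        - |1 - b| / 2 * ‖Complex.sin ((1 - a : ℝ) * z)‖ := by gcongr
    _ = ‖(1 + b) / 2 * Complex.sin ((1 + a : ℝ) * z)‖
        - ‖(1 - b) / 2 * Complex.sin ((1 - a : ℝ) * z)‖ := by rw [norm_mul, norm_mul, n1, n2]
    _ ≤ _ := by
      have := norm_sub_norm_le ((1 + b) / 2 * Complex.sin ((1 + a : ℝ) * z))
        (-((1 - b) / 2 * Complex.sin ((1 - a : ℝ) * z)))
      rwa [norm_neg, sub_neg_eq_add] at this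

/-! ### The kernel and its residues -/

/-- The numerator `sin (a z) cos z` of the quotient expanded in partial fractions. -/
noncomputable def cNum (a : ℝ) (z : ℂ) : ℂ := Complex.sin (a * z) * Complex.cos z

theorem cNum_neg (a : ℝ) (z : ℂ) : cNum a (-z) = -cNum a z := by
  simp [cNum]

theorem norm_cNum_le {a : ℝ} (ha : 0 < a) (z : ℂ) :
    ‖cNum a z‖ ≤ Real.cosh ((1 + a) * z.im) := by
  rw [cNum, norm_mul]
  calc _ ≤ Real.cosh (a * z.im) * Real.cosh z.im := by
        gcongr
        · simpa using Complex.norm_sin_le_cosh (a * z)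
        · exact Complex.norm_cos_le_cosh z
    _ ≤ _ := by
        rw [show (1 + a) * z.im = a * z.im + z.im by ring, Real.cosh_add]
        refine le_add_of_nonneg_right ?_
        rcases le_total 0 z.im with h | h
        · exact mul_nonneg (Real.sinh_nonneg_iff.2 (by positivity)) (Real.sinh_nonneg_iff.2 h)
        · exact mul_nonneg_of_nonpos_of_nonpos
            (Real.sinh_nonpos_iff.2 (mul_nonpos_of_nonneg_of_nonpos ha.le h))
            (Real.sinh_nonpos_iff.2 h)

/-- The function whose residues give the partial fraction expansion at `-s ^ 2`. -/
noncomputable def kernelFn (a b s : ℝ) (z : ℂ) : ℂ :=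
  cNum a z / (cCharFn a b z * (z * (z ^ 2 + s ^ 2)))

/-- The residues of `kernelFn`. -/
noncomputable def kernelRes (a b s : ℝ) (w : ℂ) : ℂ :=
  if w = 0 then a / (1 + a * b) / s ^ 2
  else if cCharFn a b w * (w * (w ^ 2 + s ^ 2)) = 0 then
    cNum a w / (cCharDeriv a b w * (w * (w ^ 2 + s ^ 2)) + cCharFn a b w * (3 * w ^ 2 + s ^ 2))
  else 0

theorem hasDerivAt_cNum (a : ℝ) (z : ℂ) : HasDerivAt (cNum a)
    (a * (Complex.cos (a * z) * Complex.cos z) - Complex.sin (a * z) * Complex.sin z) z := by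
  have h1 : HasDerivAt (fun x : ℂ => a * x) a z := by simpa using (hasDerivAt_id z).const_mul (a : ℂ)
  refine (h1.csin.mul (Complex.hasDerivAt_cos z)).congr_deriv ?_
  ring

theorem hasDerivAt_kernel_denominator (a b s : ℝ) (z : ℂ) :
    HasDerivAt (fun z : ℂ => cCharFn a b z * (z * (z ^ 2 + s ^ 2)))
      (cCharDeriv a b z * (z * (z ^ 2 + s ^ 2)) + cCharFn a b z * (3 * z ^ 2 + s ^ 2)) z := by
  have h1 : HasDerivAt (fun z : ℂ => z * (z ^ 2 + (s : ℂ) ^ 2)) (3 * z ^ 2 + s ^ 2) z := by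
    have := (hasDerivAt_id z).mul ((hasDerivAt_pow 2 z).add_const ((s : ℂ) ^ 2))
    refine this.congr_deriv ?_
    simp; ring
  exact (hasDerivAt_cCharFn a b z).mul h1

theorem meromorphicOn_kernelFn (a b s : ℝ) : MeromorphicOn (kernelFn a b s) Set.univ := by
  have h1 : Differentiable ℂ (cNum a) := fun z => (hasDerivAt_cNum a z).differentiableAt
  have h2 : Differentiable ℂ (fun z : ℂ => cCharFn a b z * (z * (z ^ 2 + s ^ 2))) :=
    fun z => (hasDerivAt_kernel_denominator a b s z).differentiableAt
  exact fun z _ => (h1.analyticAt z).meromorphicAt.div (h2.analyticAt z).meromorphicAt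

theorem continuousAt_kernelFn {a b s : ℝ} {w : ℂ}
    (hw : cCharFn a b w * (w * (w ^ 2 + s ^ 2)) ≠ 0) : ContinuousAt (kernelFn a b s) w :=
  (hasDerivAt_cNum a w).continuousAt.div (hasDerivAt_kernel_denominator a b s w).continuousAt hw

theorem exists_real_of_cCharFn_eq_zero {a b : ℝ} (ha : 0 < a) (hb : 0 < b) {w : ℂ}
    (h : cCharFn a b w = 0) : ∃ x : ℝ, w = x ∧ charFn a b x = 0 := by
  have him := im_eq_zero_of_cCharFn_eq_zero ha hb h
  have hw : w = (w.re : ℂ) := Complex.ext (by simp) (by simp [him])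
  refine ⟨w.re, hw, ?_⟩
  rw [hw, cCharFn_ofReal] at h
  exact_mod_cast h

theorem ofReal_sq_add_sq_ne_zero {s : ℝ} (hs : 0 < s) (x : ℝ) : (x : ℂ) ^ 2 + (s : ℂ) ^ 2 ≠ 0 := by
  have : x ^ 2 + s ^ 2 ≠ 0 := by positivity
  exact_mod_cast this

/-- The factors never vanish together away from `0`: zeros of the characteristic function are real
and simple, while those of `w ^ 2 + s ^ 2` are simple and not real. -/
theorem kernel_denominator_deriv_ne_zero {a b s : ℝ} (ha : 0 < a) (hb : 0 < b) (hs : 0 < s) {w : ℂ}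
    (hw0 : w ≠ 0) (hw : cCharFn a b w * (w * (w ^ 2 + s ^ 2)) = 0) :
    cCharDeriv a b w * (w * (w ^ 2 + s ^ 2)) + cCharFn a b w * (3 * w ^ 2 + s ^ 2) ≠ 0 := by
  by_cases hD : cCharFn a b w = 0
  · obtain ⟨x, rfl, hx⟩ := exists_real_of_cCharFn_eq_zero ha hb hD
    rw [hD, zero_mul, add_zero, cCharDeriv_ofReal]
    exact mul_ne_zero (Complex.ofReal_ne_zero.2 (charDeriv_ne_zero ha hb hx))
      (mul_ne_zero hw0 (ofReal_sq_add_sq_ne_zero hs x))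
  · have h0 : w ^ 2 + (s : ℂ) ^ 2 = 0 := by simpa [hD, hw0] using hw
    have h1 : 3 * w ^ 2 + (s : ℂ) ^ 2 = 2 * w ^ 2 := by linear_combination h0
    rw [h0, h1, mul_zero, mul_zero, zero_add]
    exact mul_ne_zero hD (mul_ne_zero two_ne_zero (pow_ne_zero 2 hw0))

theorem tendsto_sub_mul_kernelFn {a b s : ℝ} (ha : 0 < a) (hb : 0 < b) (hs : 0 < s) (w : ℂ) :
    Tendsto (fun z => (z - w) * kernelFn a b s z) (𝓝[≠] w) (𝓝 (kernelRes a b s w)) := by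
  rw [kernelRes]
  split_ifs with h0 hd
  · subst h0
    -- Numerator and characteristic function both vanish at `0`; their quotient tends to `a / (1 + a
    -- b)`, so only the factor `1 / z` produces a pole.
    have hN : cNum a 0 = 0 := by simp [cNum]
    have hD : cCharFn a b 0 = 0 := by simp [cCharFn]
    have h1 := hasDerivAt_iff_tendsto_slope.1 (hasDerivAt_cNum a 0)
    have h2 := hasDerivAt_iff_tendsto_slope.1 (hasDerivAt_cCharFn a b 0)
    have hs2 : (s : ℂ) ^ 2 ≠ 0 := by exact_mod_cast (pow_pos hs 2).ne'
    have hab : (1 + a * b : ℂ) ≠ 0 := by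
      have : 1 + a * b ≠ 0 := by positivity
      exact_mod_cast this
    have h3 : Tendsto (fun z : ℂ => z ^ 2 + (s : ℂ) ^ 2) (𝓝[≠] 0) (𝓝 ((s : ℂ) ^ 2)) := by
      have : ContinuousAt (fun z : ℂ => z ^ 2 + (s : ℂ) ^ 2) 0 := by fun_prop
      simpa using this.tendsto.mono_left nhdsWithin_le_nhds
    have hder : cCharDeriv a b 0 = 1 + a * b := by simp [cCharDeriv]
    rw [hder] at h2
    have h4 := (h1.div h2 hab).div h3 hs2
    simp only [mul_zero, Complex.cos_zero, Complex.sin_zero, mul_one, sub_zero] at h4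
    refine h4.congr' ?_
    filter_upwards [self_mem_nhdsWithin] with z hz
    have hz : z ≠ 0 := hz
    simp only [Pi.div_apply, slope_def_field, hN, hD, sub_zero, kernelFn]
    rw [div_div_div_cancel_right₀ hz, div_div, mul_div_assoc',
      show cCharFn a b z * (z * (z ^ 2 + (s : ℂ) ^ 2)) = z * (cCharFn a b z * (z ^ 2 + (s : ℂ) ^ 2))
        by ring, mul_div_mul_left _ _ hz]
  · exact tendsto_sub_mul_div_of_simple_zero (hasDerivAt_cNum a w).continuousAt
      (hasDerivAt_kernel_denominator a b s w) hd (kernel_denominator_deriv_ne_zero ha hb hs h0 hd)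
  · have hc : ContinuousAt (fun z => (z - w) * kernelFn a b s z) w := by
      have := continuousAt_kernelFn hd
      fun_prop
    simpa using hc.tendsto.mono_left nhdsWithin_le_nhds

/-- The kernel is odd, and an odd function has equal residues at opposite points. This is the source
of the factor `2` in the series. -/
theorem kernelRes_neg (a b s : ℝ) (w : ℂ) : kernelRes a b s (-w) = kernelRes a b s w := by
  have h : ∀ D κ : ℂ, -D * (-w * κ) = D * (w * κ) := fun D κ => by ring
  simp only [kernelRes, neg_eq_zero, cCharFn_neg, cCharDeriv_neg, cNum_neg, even_two.neg_pow, h]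
  refine if_congr Iff.rfl rfl (if_congr Iff.rfl ?_ rfl)
  rw [← neg_div_neg_eq]
  congr 1 <;> ring

/-- The value of the quotient at `i s`. -/
theorem kernelRes_mul_I {a b s : ℝ} (ha : 0 < a) (hb : 0 < b) (hs : 0 < s) :
    kernelRes a b s (s * Complex.I) =
      (-(Real.sinh (a * s) * Real.cosh s /
        (Real.cosh (a * s) * Real.sinh s + b * (Real.sinh (a * s) * Real.cosh s))) / (2 * s ^ 2) :
        ℝ) := by
  have hs0 : (s : ℂ) ≠ 0 := by exact_mod_cast hs.ne'
  have h1 : (s * Complex.I : ℂ) ^ 2 = -(s : ℂ) ^ 2 := by rw [mul_pow, Complex.I_sq]; ring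
  have hN : cNum a (s * Complex.I) = (Real.sinh (a * s) * Real.cosh s : ℝ) * Complex.I := by
    rw [cNum, ← mul_assoc, Complex.sin_mul_I, Complex.cos_mul_I]
    push_cast; ring
  have hD : cCharFn a b (s * Complex.I) =
      (Real.cosh (a * s) * Real.sinh s + b * (Real.sinh (a * s) * Real.cosh s) : ℝ)
        * Complex.I := by
    rw [cCharFn, ← mul_assoc, Complex.sin_mul_I, Complex.cos_mul_I, Complex.sin_mul_I,
      Complex.cos_mul_I]
    push_cast; ring
  have hpos : 0 < Real.cosh (a * s) * Real.sinh s + b * (Real.sinh (a * s) * Real.cosh s) := by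
    have := Real.sinh_pos_iff.2 hs
    have := Real.sinh_pos_iff.2 (mul_pos ha hs)
    have := Real.cosh_pos s
    have := Real.cosh_pos (a * s)
    positivity
  rw [kernelRes, if_neg (mul_ne_zero hs0 Complex.I_ne_zero), if_pos (by rw [h1]; ring), h1, hN, hD]
  generalize Real.cosh (a * s) * Real.sinh s + b * (Real.sinh (a * s) * Real.cosh s) = D at hpos
  generalize Real.sinh (a * s) * Real.cosh s = N
  have hD0 : (D : ℂ) ≠ 0 := by exact_mod_cast hpos.ne'
  have hI := Complex.I_ne_zero
  push_cast
  rw [neg_add_cancel, mul_zero, mul_zero, zero_add]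
  field_simp
  ring

theorem kernelRes_ofReal {a b s q : ℝ} (hq : q ≠ 0) (h : charFn a b q = 0) :
    kernelRes a b s q =
      (Real.sin (a * q) * Real.cos q / (charDeriv a b q * (q * (q ^ 2 + s ^ 2))) : ℝ) := by
  rw [kernelRes, if_neg (Complex.ofReal_ne_zero.2 hq), cCharFn_ofReal, h, cCharDeriv_ofReal,
    if_pos (by simp), cNum]
  push_cast
  ring

theorem kernelRes_eq_zero {a b s q : ℝ} (hb : b ≠ 0) (hq : q ≠ 0) (h : charFn a b q = 0)
    (hc : Real.cos q = 0 ∨ Real.cos (a * q) = 0) : kernelRes a b s q = 0 := by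
  rw [kernelRes_ofReal hq h, (cos_eq_zero_of_charFn_eq_zero hb h hc).1]
  simp

/-! ### Contour integration and passage to the limit -/

theorem norm_kernelFn_le {a b s c R : ℝ} (ha : 0 < a) (hc : 0 < c) (hs : 0 < s) (hsR : s < R)
    {z : ℂ} (hz : ‖z‖ = R) (h : c * Real.cosh ((1 + a) * z.im) ≤ ‖cCharFn a b z‖) :
    ‖kernelFn a b s z‖ ≤ (c * (R * (R ^ 2 - s ^ 2)))⁻¹ := by
  have hC := Real.cosh_pos ((1 + a) * z.im)
  have h1 : R ^ 2 - s ^ 2 ≤ ‖z ^ 2 + (s : ℂ) ^ 2‖ := by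
    have := norm_sub_norm_le (z ^ 2) (-(s : ℂ) ^ 2)
    rwa [norm_neg, norm_pow, norm_pow, hz, Complex.norm_real, Real.norm_of_nonneg hs.le,
      sub_neg_eq_add] at this
  have h2 : 0 < R ^ 2 - s ^ 2 := by nlinarith
  have hR : 0 < R := hs.trans hsR
  rw [kernelFn, norm_div, norm_mul, norm_mul, hz]
  calc ‖cNum a z‖ / (‖cCharFn a b z‖ * (R * ‖z ^ 2 + (s : ℂ) ^ 2‖))
      ≤ Real.cosh ((1 + a) * z.im) /
        (c * Real.cosh ((1 + a) * z.im) * (R * (R ^ 2 - s ^ 2))) := by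
        gcongr
        exact norm_cNum_le ha z
    _ = _ := by field_simp

/-- The sum of all residues of the kernel in a disc on whose boundary the characteristic function
is bounded below. -/
theorem circleIntegral_kernelFn {a b s c R : ℝ} (ha : 0 < a) (hb : 0 < b) (hs : 0 < s)
    (hc : 0 < c) (hsR : s < R) {q : ℕ → ℝ} (hqm : StrictMono q)
    (hq : ∀ x > 0, (charFn a b x = 0 ∧ Real.cos x ≠ 0 ∧ Real.cos (a * x) ≠ 0) → x ∈ Set.range q)
    (hqpos : ∀ n, 0 < q n) (A : Finset ℕ) (hA : ∀ n, n ∈ A ↔ q n < R)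
    (h : ∀ z : ℂ, ‖z‖ = R → c * Real.cosh ((1 + a) * z.im) ≤ ‖cCharFn a b z‖) :
    (∮ z in C(0, R), kernelFn a b s z) = 2 * Real.pi * Complex.I *
      (kernelRes a b s 0 + 2 * kernelRes a b s (s * Complex.I)
        + 2 * ∑ n ∈ A, kernelRes a b s (q n)) := by
  classical
  have hR : 0 < R := hs.trans hsR
  have hD : ∀ z : ℂ, ‖z‖ = R → cCharFn a b z ≠ 0 := fun z hz h0 => by
    have := h z hz
    rw [h0, norm_zero] at this
    exact absurd this (not_le.2 (mul_pos hc (Real.cosh_pos _)))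
  set P : Finset ℂ := A.image (fun n => (q n : ℂ)) with hP
  set P' : Finset ℂ := A.image (fun n => -(q n : ℂ)) with hP'
  set S : Finset ℂ := insert 0 (insert (s * Complex.I) (insert (-(s * Complex.I)) (P ∪ P')))
  have hsI : (s * Complex.I : ℂ) ≠ 0 := by simp [hs.ne']
  have hdisj : Disjoint P P' := by
    rw [Finset.disjoint_left]
    intro w hw hw'
    obtain ⟨n, -, rfl⟩ := Finset.mem_image.1 hw
    obtain ⟨m, -, hm⟩ := Finset.mem_image.1 hw'
    have := congrArg Complex.re hm
    simp only [Complex.neg_re, Complex.ofReal_re] at this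
    linarith [hqpos n, hqpos m]
  have hsum : ∑ w ∈ S, kernelRes a b s w = kernelRes a b s 0
      + 2 * kernelRes a b s (s * Complex.I) + 2 * ∑ n ∈ A, kernelRes a b s (q n) := by
    have n1 : (0 : ℂ) ∉ insert (s * Complex.I) (insert (-(s * Complex.I)) (P ∪ P')) := by
      simp [hP, hP', hs.ne', fun n => (hqpos n).ne']
    have him : ∀ w ∈ P ∪ P', w.im = 0 := by
      intro w hw
      rcases Finset.mem_union.1 hw with hw | hw <;>
        obtain ⟨n, -, rfl⟩ := Finset.mem_image.1 hw <;> simp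
    have n2 : (s * Complex.I : ℂ) ∉ insert (-(s * Complex.I)) (P ∪ P') := by
      rw [Finset.mem_insert, not_or]
      refine ⟨fun hh => ?_, fun hh => hs.ne' (by simpa using him _ hh)⟩
      exact hsI (self_eq_neg.1 hh)
    have n3 : (-(s * Complex.I) : ℂ) ∉ P ∪ P' := fun hh => hs.ne' (by simpa using him _ hh)
    rw [Finset.sum_insert n1, Finset.sum_insert n2, Finset.sum_insert n3,
      Finset.sum_union hdisj, Finset.sum_image, Finset.sum_image]
    · simp only [kernelRes_neg]; ring
    · intro m _ n _ hmn
      exact hqm.injective (Complex.ofReal_injective (neg_injective hmn))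
    · intro m _ n _ hmn
      exact hqm.injective (Complex.ofReal_injective hmn)
  rw [← hsum]
  refine circleIntegral_eq_sum_simple_residues hR (meromorphicOn_kernelFn a b s) ?_ S _ ?_
    (fun w _ => tendsto_sub_mul_kernelFn ha hb hs w) ?_
  · intro z hz
    rw [mem_sphere_zero_iff_norm] at hz
    refine (continuousAt_kernelFn (mul_ne_zero (hD z hz) (mul_ne_zero ?_ ?_))).continuousWithinAt
    · rintro rfl; rw [norm_zero] at hz; exact hR.ne hz
    · intro h0
      have : ‖z ^ 2‖ = ‖(s : ℂ) ^ 2‖ := by rw [eq_neg_of_add_eq_zero_left h0, norm_neg]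
      rw [norm_pow, norm_pow, hz, Complex.norm_real, Real.norm_of_nonneg hs.le] at this
      nlinarith
  · intro w hw
    rw [mem_ball_zero_iff]
    have hqR : ∀ n ∈ A, ‖(q n : ℂ)‖ < R := fun n hn => by
      rw [Complex.norm_real, Real.norm_of_nonneg (hqpos n).le]; exact (hA n).1 hn
    have hsn : ‖(s * Complex.I : ℂ)‖ < R := by
      simpa [abs_of_pos hs] using hsR
    simp only [S, Finset.mem_insert, Finset.mem_union, hP, hP', Finset.mem_image] at hw
    rcases hw with rfl | rfl | rfl | ⟨n, hn, rfl⟩ | ⟨n, hn, rfl⟩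
    · simpa using hR
    · exact hsn
    · rwa [norm_neg]
    · exact hqR n hn
    · rw [norm_neg]; exact hqR n hn
  · intro w hw hwS
    rw [mem_closedBall_zero_iff] at hw
    have := tendsto_sub_mul_kernelFn (a := a) (b := b) ha hb hs w
    suffices hz : kernelRes a b s w = 0 by rwa [hz] at this
    simp only [S, Finset.mem_insert, Finset.mem_union, hP, hP', Finset.mem_image, not_or] at hwS
    obtain ⟨w0, w1, w2, w3, w4⟩ := hwS
    by_cases hDw : cCharFn a b w = 0
    · have hwR : ‖w‖ < R := hw.lt_of_ne fun hh => hD w hh hDw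
      obtain ⟨x, rfl, hx⟩ := exists_real_of_cCharFn_eq_zero ha hb hDw
      rw [Complex.norm_real, Real.norm_eq_abs, abs_lt] at hwR
      have hx0 : x ≠ 0 := by rintro rfl; exact w0 (by simp)
      refine kernelRes_eq_zero hb.ne' hx0 hx ?_
      by_contra! hcos
      rcases hx0.lt_or_gt with hneg | hpos
      · have hxn : charFn a b (-x) = 0 := by
          rw [charFn] at hx ⊢
          simp only [mul_neg, Real.sin_neg, Real.cos_neg]
          linarith
        obtain ⟨n, hn⟩ := hq (-x) (by linarith) ⟨hxn, by simpa using hcos⟩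
        exact w4 ⟨n, (hA n).2 (by linarith), by rw [hn]; simp⟩
      · obtain ⟨n, hn⟩ := hq x hpos ⟨hx, hcos⟩
        exact w3 ⟨n, (hA n).2 (by linarith), by rw [hn]⟩
    · rw [kernelRes, if_neg w0, if_neg]
      refine mul_ne_zero hDw (mul_ne_zero w0 fun h0 => ?_)
      have hfac : (w - s * Complex.I) * (w + s * Complex.I) = 0 := by
        linear_combination h0 - (s : ℂ) ^ 2 * Complex.I_sq
      rcases mul_eq_zero.1 hfac with hh | hh
      · exact w1 (sub_eq_zero.1 hh)
      · exact w2 (eq_neg_of_add_eq_zero_left hh)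

/-- The terms of the residue series. -/
noncomputable def resTerm (a b s q : ℝ) : ℝ :=
  Real.sin (a * q) * Real.cos q / (charDeriv a b q * (q * (q ^ 2 + s ^ 2)))

/-- Linear growth of `q n` and the uniform lower bound on the derivative make the terms `O(n⁻³)`. -/
theorem summable_resTerm {a b s d : ℝ} (ha : 0 < a) (hb : 0 < b) (hd : 0 < d) {q : ℕ → ℝ}
    (hgrow : ∀ n : ℕ, d * (n + 1) ≤ q n) (hq0 : ∀ n, charFn a b (q n) = 0) :
    Summable fun n => resTerm a b s (q n) := by
  have hm : 0 < min 1 b := lt_min one_pos hb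
  have hs1 : Summable fun n : ℕ => (min 1 b * d ^ 3)⁻¹ * (1 / ((n + 1 : ℕ) : ℝ) ^ 3) :=
    ((summable_nat_add_iff 1).2
      (Real.summable_one_div_nat_pow.2 (by norm_num : 1 < 3))).mul_left _
  refine Summable.of_norm_bounded hs1 fun n => ?_
  have hn : 0 < d * (n + 1) := by positivity
  have hqn := hn.trans_le (hgrow n)
  rw [resTerm, norm_div, norm_mul, norm_mul]
  have h1 : ‖Real.sin (a * q n)‖ * ‖Real.cos (q n)‖ ≤ 1 :=
    mul_le_one₀ (Real.abs_sin_le_one _) (norm_nonneg _) (Real.abs_cos_le_one _)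
  have h2 := min_le_abs_charDeriv ha hb (hq0 n)
  have h3 : (d * (n + 1)) ^ 3 ≤ ‖q n * (q n ^ 2 + s ^ 2)‖ := by
    rw [Real.norm_of_nonneg (by positivity)]
    calc (d * (n + 1)) ^ 3 ≤ q n ^ 3 := pow_le_pow_left₀ hn.le (hgrow n) 3
      _ ≤ _ := by nlinarith [sq_nonneg s]
  calc _ ≤ 1 / (min 1 b * (d * (n + 1)) ^ 3) :=
        div_le_div₀ zero_le_one h1 (by positivity)
          (mul_le_mul h2 h3 (by positivity) (abs_nonneg _))
    _ = _ := by push_cast; field_simp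

/-- The partial fraction expansion, evaluated at `-s ^ 2`. -/
theorem tsum_resTerm {a b s d : ℝ} (ha : 0 < a) (hb : 0 < b) (hs : 0 < s) (hd : 0 < d)
    {q : ℕ → ℝ} (hqm : StrictMono q) (hgrow : ∀ n : ℕ, d * (n + 1) ≤ q n)
    (hq0 : ∀ n, charFn a b (q n) = 0)
    (hq : ∀ x > 0, (charFn a b x = 0 ∧ Real.cos x ≠ 0 ∧ Real.cos (a * x) ≠ 0) → x ∈ Set.range q) :
    a / (1 + a * b) / s ^ 2 + 2 * ∑' n, resTerm a b s (q n) =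
      Real.sinh (a * s) * Real.cosh s /
        (Real.cosh (a * s) * Real.sinh s + b * (Real.sinh (a * s) * Real.cosh s)) / s ^ 2 := by
  have hqpos : ∀ n, 0 < q n := fun n => lt_of_lt_of_le (by positivity) (hgrow n)
  set V := Real.sinh (a * s) * Real.cosh s /
        (Real.cosh (a * s) * Real.sinh s + b * (Real.sinh (a * s) * Real.cosh s)) with hV
  -- The growth bound gives `n < radius a k / d` whenever `q n < radius a k`, so the cutoff loses no
  -- index.
  set A : ℕ → Finset ℕ := fun k =>
    (Finset.range ⌈radius a k / d⌉₊).filter fun n => q n < radius a k with hAdef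
  have hA : ∀ k n, n ∈ A k ↔ q n < radius a k := by
    intro k n
    rw [hAdef, Finset.mem_filter, Finset.mem_range, and_iff_right_iff_imp]
    intro h
    rw [Nat.lt_ceil, lt_div_iff₀ hd]
    linarith [hgrow n]
  have hAt : Tendsto A atTop atTop := by
    rw [Filter.tendsto_atTop]
    intro F
    have hF : ∀ n ∈ F, ∀ᶠ k in atTop, n ∈ A k := fun n _ => by
      filter_upwards [(tendsto_radius ha).eventually_gt_atTop (q n)] with k hk
      exact (hA k n).2 hk
    filter_upwards [(eventually_all_finset F).2 hF] with k hk
    exact hk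
  have hlim1 := (summable_resTerm (s := s) ha hb hd hgrow hq0).hasSum.comp hAt
  have hlim2 : Tendsto (fun k => a / (1 + a * b) / s ^ 2 + 2 * (-V / (2 * s ^ 2))
      + 2 * ∑ n ∈ A k, resTerm a b s (q n)) atTop (𝓝 0) := by
    obtain ⟨c, hc, hev⟩ := exists_mul_cosh_le_norm_cCharFn ha hb
    have hbd : Tendsto (fun k => (c * ((radius a k) ^ 2 - s ^ 2))⁻¹) atTop (𝓝 0) :=
      tendsto_inv_atTop_zero.comp ((tendsto_atTop_add_const_right _ _
        ((tendsto_pow_atTop two_ne_zero).comp (tendsto_radius ha))).const_mul_atTop hc)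
    refine squeeze_zero_norm' ?_ hbd
    filter_upwards [hev, (tendsto_radius ha).eventually_gt_atTop s] with k hk hsR
    have hRpos := radius_pos ha k
    have hint := circleIntegral_kernelFn ha hb hs hc hsR hqm hq hqpos (A k) (hA k) hk
    -- The normalised integral is at most `R` times the kernel bound, which leaves order `R⁻²`.
    have hle := circleIntegral.norm_two_pi_i_inv_smul_integral_le_of_norm_le_const (c := 0)
      hRpos.le fun z hz => norm_kernelFn_le ha hc hs hsR (mem_sphere_zero_iff_norm.1 hz)
        (hk z (mem_sphere_zero_iff_norm.1 hz))
    have hcast : kernelRes a b s 0 + 2 * kernelRes a b s (s * Complex.I)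
        + 2 * ∑ n ∈ A k, kernelRes a b s (q n) =
        ((a / (1 + a * b) / s ^ 2 + 2 * (-V / (2 * s ^ 2))
          + 2 * ∑ n ∈ A k, resTerm a b s (q n) : ℝ) : ℂ) := by
      have e1 : ∀ n ∈ A k, kernelRes a b s (q n) = (resTerm a b s (q n) : ℝ) := fun n _ =>
        kernelRes_ofReal (hqpos n).ne' (hq0 n)
      rw [Finset.sum_congr rfl e1, kernelRes_mul_I ha hb hs, ← hV, kernelRes, if_pos rfl]
      push_cast
      ring
    rw [hint, hcast, smul_eq_mul, inv_mul_cancel_left₀ Complex.two_pi_I_ne_zero,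
      Complex.norm_real] at hle
    refine hle.trans (le_of_eq ?_)
    field_simp
  have huniq := tendsto_nhds_unique hlim2 ((hlim1.const_mul 2).const_add _)
  have : 2 * (-V / (2 * s ^ 2)) = -(V / s ^ 2) := by field_simp
  rw [this] at huniq
  linarith

/-! ### Return to the original parameters -/

theorem residueG_eq_charDeriv {ε γ : ℝ} (hε : 0 < ε) (q : ℝ) :
    residueG ε γ q = charDeriv √ε (-γ / √ε) q := by
  have ha : √ε ≠ 0 := (Real.sqrt_pos.2 hε).ne'
  rw [residueG, charDeriv, mul_comm q]
  field_simp
  ring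

theorem mem_posRoots_iff {ε γ q : ℝ} : q ∈ posRoots ε γ ↔
    0 < q ∧ charFn √ε (-γ / √ε) q = 0 ∧ Real.cos q ≠ 0 ∧ Real.cos (√ε * q) ≠ 0 := by
  have key : Real.cos q ≠ 0 → Real.cos (√ε * q) ≠ 0 →
      (Real.tan q = γ / √ε * Real.tan (√ε * q) ↔ charFn √ε (-γ / √ε) q = 0) := by
    intro h1 h2
    rw [Real.tan_eq_sin_div_cos, Real.tan_eq_sin_div_cos, charFn, ← mul_div_assoc,
      div_eq_div_iff h1 h2, neg_div]
    constructor <;> intro h <;> linarith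
  rw [posRoots, Set.mem_ofPred_eq, mul_comm q]
  constructor
  · rintro ⟨h0, h1, h2, h3⟩; exact ⟨h0, (key h1 h2).1 h3, h1, h2⟩
  · rintro ⟨h0, h3, h1, h2⟩; exact ⟨h0, h1, h2, (key h1 h2).2 h3⟩

theorem mainTheorem1 (ε w₁ βs γ : ℝ) (hε : 0 < ε) (hγ : γ = w₁ * βs) (hneg : γ < 0) :
    ∃ q : ℕ → ℝ, StrictMono q ∧ Set.range q = posRoots ε γ ∧
      (∀ n, residueG ε γ (q n) ≠ 0) ∧
      ∀ p : ℝ, 0 < p →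
        realCoth √(ε * p) * Real.tanh √p - γ / √ε ≠ 0 ∧
        Summable (fun n : ℕ =>
          Real.cos (q n) * Real.sin (q n * √ε) /
            (q n * (1 + q n ^ 2 / p) * residueG ε γ (q n))) ∧
        √ε / (1 - γ) + 2 * ∑' n : ℕ,
          Real.cos (q n) * Real.sin (q n * √ε) /
            (q n * (1 + q n ^ 2 / p) * residueG ε γ (q n))
          = 1 / (realCoth √(ε * p) * Real.tanh √p - γ / √ε) := by
  obtain ⟨a, ha_def⟩ : ∃ a, a = √ε := ⟨_, rfl⟩
  obtain ⟨b, hb_def⟩ : ∃ b, b = -γ / √ε := ⟨_, rfl⟩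
  have ha : 0 < a := ha_def ▸ Real.sqrt_pos.2 hε
  have hb : 0 < b := by rw [hb_def, ← ha_def]; exact div_pos (neg_pos.2 hneg) ha
  have hγab : 1 - γ = 1 + a * b := by rw [hb_def, ← ha_def]; field_simp; ring
  have hγb : γ / √ε = -b := by rw [hb_def]; ring
  have hmem : ∀ x, x ∈ posRoots ε γ ↔
      0 < x ∧ charFn a b x = 0 ∧ Real.cos x ≠ 0 ∧ Real.cos (a * x) ≠ 0 := by
    intro x; rw [ha_def, hb_def]; exact mem_posRoots_iff
  have hG : ∀ x, residueG ε γ x = charDeriv a b x := by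
    intro x; rw [ha_def, hb_def]; exact residueG_eq_charDeriv hε x
  obtain ⟨d, hd, hgap⟩ := exists_charFn_gap ha hb
  obtain ⟨q, hqm, hqr, hgrow⟩ := exists_strictMono_range_eq (s := posRoots ε γ) hd
    (fun x hx => by
      have h := (hmem x).1 hx
      -- The origin is itself a zero of the characteristic function, so the gap also bounds the
      -- roots away from `0`.
      simpa using hgap 0 x (by simp [charFn]) h.2.1 h.1)
    (fun x hx y hy hxy => hgap x y ((hmem x).1 hx).2.1 ((hmem y).1 hy).2.1 hxy)
    (fun M => by
      obtain ⟨x, hx, h⟩ := exists_charFn_zero_gt ha hb (max M 0)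
      exact ⟨x, (hmem x).2 ⟨(le_max_right _ _).trans_lt hx, h⟩, (le_max_left _ _).trans_lt hx⟩)
  have hq0 : ∀ n, charFn a b (q n) = 0 := fun n => ((hmem _).1 (hqr ▸ Set.mem_range_self n)).2.1
  refine ⟨q, hqm, hqr, fun n => ?_, fun p hp => ?_⟩
  · rw [hG]; exact charDeriv_ne_zero ha hb (hq0 n)
  obtain ⟨s, hs_def⟩ : ∃ s, s = √p := ⟨_, rfl⟩
  have hs : 0 < s := hs_def ▸ Real.sqrt_pos.2 hp
  have hps : p = s ^ 2 := by rw [hs_def, Real.sq_sqrt hp.le]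
  -- The stated series is `p = s ^ 2` times the residue series, as `1 + q² / p = (q² + s²) / s²`.
  have hterm : ∀ n, Real.cos (q n) * Real.sin (q n * √ε) /
      (q n * (1 + q n ^ 2 / p) * residueG ε γ (q n)) = s ^ 2 * resTerm a b s (q n) := by
    intro n
    have hqn : 0 < q n := lt_of_lt_of_le (by positivity) (hgrow n)
    have hG0 := charDeriv_ne_zero ha hb (hq0 n)
    have hsq : q n ^ 2 + s ^ 2 ≠ 0 := by positivity
    have hsq' : s ^ 2 + q n ^ 2 ≠ 0 := by positivity
    rw [hG, ← ha_def, hps, resTerm, mul_comm (q n) a]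
    field_simp
    ring
  have hsinh := Real.sinh_pos_iff.2 hs
  have hsinh' := Real.sinh_pos_iff.2 (mul_pos ha hs)
  have hcosh := Real.cosh_pos s
  have hcosh' := Real.cosh_pos (a * s)
  have hrhs : realCoth √(ε * p) * Real.tanh √p - γ / √ε =
      (Real.cosh (a * s) * Real.sinh s + b * (Real.sinh (a * s) * Real.cosh s)) /
        (Real.sinh (a * s) * Real.cosh s) := by
    rw [hγb, Real.sqrt_mul hε.le, ← ha_def, ← hs_def, realCoth, Real.tanh_eq_sinh_div_cosh]
    field_simp
    ring
  have hsum := summable_resTerm (s := s) ha hb hd hgrow hq0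
  simp only [hterm]
  refine ⟨?_, hsum.mul_left _, ?_⟩
  · rw [hrhs]; positivity
  · have hmain := tsum_resTerm ha hb hs hd hqm hgrow hq0
      fun x hx h => hqr ▸ (hmem x).2 ⟨hx, h⟩
    rw [tsum_mul_left, hrhs, one_div_div, hγab, ← ha_def]
    have hs2 : s ^ 2 ≠ 0 := by positivity
    have h2 := congrArg (s ^ 2 * ·) hmain
    simp only [mul_add, mul_div_cancel₀ _ hs2] at h2
    linarith
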